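/- For every sample size $n\ge 1$ let $p=p(n)$ be a dimension, $\gamma_n=p/n$, let $\Pi=\Pi_n$ be a real $p\times p$ orthogonal projection matrix ($\Pi^\top=\Pi$, $\Pi^2=\Pi$) with $\operatorname{rank}(\Pi_n)=o(p)$ as $n\to\infty$, and put $U_n=I_p-2\Pi_n$ (an orthogonal matrix). Let $\Lambda_n=\operatorname{diag}(\lambda_1,\dots,\lambda_p)$ be any diagonal matrices with non-negative entries that are bounded by a constant not depending on $n$, for all large $n$, and let $\Sigma_n=U_n\Lambda_nU_n^\top$. Then $\Sigma_n$ satisfies the following eigenvector regularity condition. Let $H_n=p^{-1}\sum_{j=1}^p\delta_{\lambda_j}$ be the spectral distribution of $\Sigma_n$, and let $t_n(z)$ be the Stieltjes transform $\int (x-z)^{-1}\,dF(x)$ of $F=\mathcal F(H_n,\gamma_n)$, where $\mathcal F(H,\gamma)$ is the Marčenko–Pastur law: the unique probability measure on $\mathbb R$ whose Stieltjes transform $t$ satisfies, for all $z$ with $\Im z>0$, $$t(z)=\int\frac{dH(x)}{x\{1-\gamma-\gamma z\,t(z)\}-z}\qquad\text{and}\qquad \Im\Big\{-\frac{1-\gamma}{z}+\gamma\,t(z)\Big\}>0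 .$$ Let $\Sigma_n=V_nD_nV_n^\top$ be any spectral decomposition of $\Sigma_n$ ($V_n$ orthogonal, $D_n$ diagonal), in particular $V_n=U_n$, $D_n=\Lambda_n$. Then for $z\in\mathbb C\setminus\mathbb R$ the matrix $-zI_p+\{(1-\gamma_n)-z\gamma_nt_n(z)\}D_n$ is invertible, and with $$\Gamma_{n,\ell}(z)=D_n^{1/2}\Big[-zI_p+\{(1-\gamma_n)-z\gamma_nt_n(z)\}D_n\Big]^{-\ell}D_n^{1/2},\qquad \ell\in\{1,2\},$$ we have, for all fixed $z_1,z_2\in\mathbb C\setminus\mathbb R$ and each $\ell\in\{1,2\}$, as $n\to\infty$, $$\frac1p\sum_{j=1}^p\{V_n\Gamma_{n,\ell}(z_1)V_n^\top\}_{jj}\{V_n\Gamma_{n,2}(z_2)V_n^\top\}_{jj}=\frac1p\sum_{j=1}^p\{\Gamma_{n,\ell}(z_1)\}_{jj}\{\Gamma_{n,2}(z_2)\}_{jj}+o(1).$$ -/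

import Mathlib

open scoped Matrix

noncomputable section

/-- The Stieltjes transform `z ↦ ∫ 1 / (x - z) dF(x)` of a measure `F` on `ℝ`
(used for `z` off the real axis). -/
def stieltjes (F : MeasureTheory.Measure ℝ) (z : ℂ) : ℂ :=
  ∫ x : ℝ, 1 / ((x : ℂ) - z) ∂F

/-- `F` is the (generalized) Marčenko–Pastur law with population spectral distribution `H` and
aspect ratio `γ`: the probability measure on `ℝ` whose Stieltjes transform `t` solves, at every
`z` in the upper half plane, the Marčenko–Pastur equation
`t = ∫ 1 / (x (1 - γ - γ z t) - z) dH(x)`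
in the region where `-(1 - γ) / z + γ t` lies in the upper half plane. For a probability measure
`H` on `[0, ∞)` and `γ > 0` it is classical that there is exactly one such `F`, and that it is the
almost sure weak limit of the spectral distributions of sample covariance matrices of i.i.d. type
with population spectral distributions converging to `H` and dimension / sample size → `γ`. -/
structure IsMarchenkoPasturLaw (H : MeasureTheory.Measure ℝ) (γ : ℝ)
    (F : MeasureTheory.Measure ℝ) : Prop where
  isProbabilityMeasure : MeasureTheory.IsProbabilityMeasure F
  equation : ∀ z : ℂ, 0 < z.im →
    stieltjes F z = ∫ x : ℝ, 1 / ((x : ℂ) * (1 - γ - γ * z * stieltjes F z) - z) ∂H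
  companion : ∀ z : ℂ, 0 < z.im → 0 < (-(1 - (γ : ℂ)) / z + γ * stieltjes F z).im

open scoped Classical in
/-- The Marčenko–Pastur map `(H, γ) ↦ 𝓕(H, γ)` (with value `0` where no such law exists, which
does not happen for a probability measure `H` on `[0, ∞)` and `γ > 0`). -/
def marchenkoPasturMap (H : MeasureTheory.Measure ℝ) (γ : ℝ) : MeasureTheory.Measure ℝ :=
  if h : ∃ F, IsMarchenkoPasturLaw H γ F then h.choose else 0

/-- The distribution `p⁻¹ ∑ⱼ δ_{λⱼ}` of a family of `p` eigenvalues. -/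
def spectralDistribution {p : ℕ} (lam : Fin p → ℝ) : MeasureTheory.Measure ℝ :=
  (p : ENNReal)⁻¹ • ∑ j, MeasureTheory.Measure.dirac (lam j)

/-- `t_n(z)`: the Stieltjes transform of `𝓕(H_n, γ_n)`, where `H_n` is the distribution of the
eigenvalues `lam` and `γ_n = p / n`. -/
def mpStieltjes (n : ℕ) {p : ℕ} (lam : Fin p → ℝ) (z : ℂ) : ℂ :=
  stieltjes (marchenkoPasturMap (spectralDistribution lam) ((p : ℝ) / n)) z

/-- The middle factor `-z I_p + {(1 - γ_n) - z γ_n t_n(z)} Λ_n`, with `Λ_n = diag(lam)`. -/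
def middleFactor (n : ℕ) {p : ℕ} (lam : Fin p → ℝ) (z : ℂ) : Matrix (Fin p) (Fin p) ℂ :=
  (-z) • (1 : Matrix (Fin p) (Fin p) ℂ) +
    ((1 - (p : ℂ) / n) - z * ((p : ℂ) / n) * mpStieltjes n lam z) •
      Matrix.diagonal (fun j => (lam j : ℂ))

/-- `Γ_{n,ℓ}(z) = Λ_n^{1/2} [-z I_p + {(1 - γ_n) - z γ_n t_n(z)} Λ_n]^{-ℓ} Λ_n^{1/2}`. -/
def gammaMatrix (n : ℕ) {p : ℕ} (lam : Fin p → ℝ) (l : ℕ) (z : ℂ) :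
    Matrix (Fin p) (Fin p) ℂ :=
  Matrix.diagonal (fun j => ((√(lam j) : ℝ) : ℂ)) * ((middleFactor n lam z)⁻¹) ^ l *
    Matrix.diagonal (fun j => ((√(lam j) : ℝ) : ℂ))

/-- `S = U diag(lam) Uᵀ` with `U` orthogonal. -/
def IsSpectralDecomposition {p : ℕ} (S U : Matrix (Fin p) (Fin p) ℝ) (lam : Fin p → ℝ) : Prop :=
  U ∈ Matrix.orthogonalGroup (Fin p) ℝ ∧ S = U * Matrix.diagonal lam * Uᵀ

/-- The average `p⁻¹ ∑ⱼ A_{jj} B_{jj}`. -/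
def diagAverage {p : ℕ} (A B : Matrix (Fin p) (Fin p) ℂ) : ℂ :=
  (p : ℂ)⁻¹ * ∑ j, A j j * B j j

/-- The conjugate `U A Uᵀ` of a complex matrix by a real one. -/
def conjBy {p : ℕ} (U : Matrix (Fin p) (Fin p) ℝ) (A : Matrix (Fin p) (Fin p) ℂ) :
    Matrix (Fin p) (Fin p) ℂ :=
  U.map (fun x : ℝ => (x : ℂ)) * A * (U.map (fun x : ℝ => (x : ℂ)))ᵀ

/-- Regularity of the eigenvectors of a sequence of covariance matrices `S n` of size `p n`,
for sample sizes `n → ∞`: for every spectral decomposition `S n = U n diag(lam n) (U n)ᵀ`,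
the middle factors are invertible, so that the matrices `Γ_{n,ℓ}(z)` are well defined, and
`p⁻¹ ∑ⱼ {U Γ_{n,ℓ}(z₁) Uᵀ}ⱼⱼ {U Γ_{n,2}(z₂) Uᵀ}ⱼⱼ = p⁻¹ ∑ⱼ {Γ_{n,ℓ}(z₁)}ⱼⱼ {Γ_{n,2}(z₂)}ⱼⱼ + o(1)`
for all non-real `z₁, z₂` and `ℓ ∈ {1, 2}`. -/
def EigenvectorRegularity (p : ℕ → ℕ) (S : ∀ n, Matrix (Fin (p n)) (Fin (p n)) ℝ) : Prop :=
  ∀ (U : ∀ n, Matrix (Fin (p n)) (Fin (p n)) ℝ) (lam : ∀ n, Fin (p n) → ℝ),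
    (∀ n, IsSpectralDecomposition (S n) (U n) (lam n)) →
    (∀ n, ∀ z : ℂ, z.im ≠ 0 → IsUnit (middleFactor n (lam n) z)) ∧
    ∀ z₁ z₂ : ℂ, z₁.im ≠ 0 → z₂.im ≠ 0 → ∀ l : ℕ, l = 1 ∨ l = 2 →
      Filter.Tendsto
        (fun n =>
          diagAverage (conjBy (U n) (gammaMatrix n (lam n) l z₁))
              (conjBy (U n) (gammaMatrix n (lam n) 2 z₂)) -
            diagAverage (gammaMatrix n (lam n) l z₁) (gammaMatrix n (lam n) 2 z₂))
        Filter.atTop (nhds 0)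

end

/-! Each `Γ` is diagonal with entries `f (λ j)`. Conjugation by an orthogonal `U` replaces entry `j`
by the average `∑ k, U j k ^ 2 * f (λ k)`. For `U = 1 - 2P` the off-diagonal weights are `4 * P j k
^ 2`, of total at most `4 * P j j`, so averaging over `j` leaves an error of order `rank P / p` once
`f` is bounded uniformly in `n` (`norm_diagAverage_reflection_sub_le`). The uniform bound is
`min_le_norm_middleFactor_entry`: the denominators are `-z (1 + λ m)` with `m` the companion
transform, and `Im (-1/m) ≥ Im z`. An arbitrary spectral decomposition reduces to `U` because
functional calculus and traces do not depend on the decomposition. -/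

section StieltjesBounds

/-! ### Lower bounds for the denominators, from the companion transform. -/

theorem stieltjes_conj (F : MeasureTheory.Measure ℝ) (z : ℂ) :
    stieltjes F ((starRingEnd ℂ) z) = (starRingEnd ℂ) (stieltjes F z) := by
  unfold stieltjes
  rw [← integral_conj]
  congr 1
  ext x
  simp

theorem integral_spectralDistribution {p : ℕ} (lam : Fin p → ℝ) (f : ℝ → ℂ) :
    ∫ x, f x ∂(spectralDistribution lam) = (p : ℂ)⁻¹ * ∑ j, f (lam j) := by
  unfold spectralDistribution
  rw [MeasureTheory.integral_smul_measure, MeasureTheory.integral_finsetSum_measure]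
  · simp [MeasureTheory.integral_dirac, Complex.real_smul]
  · intro i _
    exact MeasureTheory.integrable_dirac (by simp)

theorem marchenkoPasturMap_isLaw_or_eq_zero (H : MeasureTheory.Measure ℝ) (γ : ℝ) :
    IsMarchenkoPasturLaw H γ (marchenkoPasturMap H γ) ∨ marchenkoPasturMap H γ = 0 := by
  unfold marchenkoPasturMap
  split_ifs with h
  · exact Or.inl h.choose_spec
  · exact Or.inr rfl

theorem one_add_real_mul_ne_zero {m : ℂ} (hm : 0 < m.im) (a : ℝ) : 1 + (a : ℂ) * m ≠ 0 := by
  intro h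
  have him := congrArg Complex.im h
  have hre := congrArg Complex.re h
  simp at him hre
  rcases him with rfl | h0
  · simp at hre
  · exact hm.ne' h0

theorem im_div_one_add_real_mul_nonpos {m : ℂ} (hm : 0 < m.im) (a : ℝ) :
    ((a : ℂ) / (1 + a * m)).im ≤ 0 := by
  rw [Complex.div_im]
  have : 0 ≤ a * (a * m.im) / Complex.normSq (1 + a * m) := by
    have := Complex.normSq_nonneg (1 + a * m)
    have := mul_self_nonneg a
    rw [← mul_assoc]
    positivity
  simpa using this

/-- A lower bound for `|1 + a m|` from `Im (-1/m) ≥ v` alone, uniform over `a ∈ [0, C]`. -/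
theorem min_le_norm_one_add_real_mul {m : ℂ} (hm : m ≠ 0) {v C a : ℝ} (hv : 0 < v)
    (hC : 0 < C) (hmv : v ≤ (-1 / m).im) (ha : 0 ≤ a) (haC : a ≤ C) :
    min (1 / 2) (v / (2 * C)) ≤ ‖1 + (a : ℂ) * m‖ := by
  -- For small `m`, `|a m| ≤ 1/2`. Otherwise `1 + a m = m (a - (-1/m))`, and the real number `a` is
  -- at distance at least `Im (-1/m)` from `-1/m`.
  rcases le_total ‖m‖ (1 / (2 * C)) with h | h
  · refine (min_le_left _ _).trans ?_
    have h1 : ‖(a : ℂ) * m‖ ≤ 1 / 2 := by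
      rw [norm_mul, Complex.norm_real, Real.norm_of_nonneg ha]
      calc a * ‖m‖ ≤ C * (1 / (2 * C)) := by gcongr
        _ = 1 / 2 := by field_simp
    have h2 := norm_sub_norm_le (1 : ℂ) (-((a : ℂ) * m))
    rw [norm_neg, norm_one, sub_neg_eq_add] at h2
    linarith
  · refine (min_le_right _ _).trans ?_
    have h1 : 1 + (a : ℂ) * m = m * (a - (-1 / m)) := by
      field_simp
      ring
    have h2 : v ≤ ‖(a : ℂ) - (-1 / m)‖ := by
      refine le_trans ?_ (Complex.abs_im_le_norm _)
      rw [Complex.sub_im, Complex.ofReal_im, zero_sub, abs_neg]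
      exact hmv.trans (le_abs_self _)
    rw [h1, norm_mul]
    calc v / (2 * C) = 1 / (2 * C) * v := by ring
      _ ≤ _ := by gcongr

/-- The Marčenko–Pastur equation in terms of the companion transform `m = -(1 - γ)/z + γ t`
forces `Im (-1/m) ≥ Im z`. -/
theorem im_le_im_neg_inv_companion {p : ℕ} (hp : 0 < p) {lam : Fin p → ℝ} {γ : ℝ} (hγ : 0 ≤ γ)
    {z t : ℂ} (hz : 0 < z.im)
    (ht : t = (p : ℂ)⁻¹ * ∑ j, 1 / ((lam j : ℂ) * (1 - γ - γ * z * t) - z))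
    (hm : 0 < (-(1 - (γ : ℂ)) / z + γ * t).im) :
    z.im ≤ (-1 / (-(1 - (γ : ℂ)) / z + γ * t)).im := by
  have hz0 : z ≠ 0 := by rintro rfl; simp at hz
  have hp0 : (p : ℂ) ≠ 0 := by exact_mod_cast hp.ne'
  set m := -(1 - (γ : ℂ)) / z + γ * t with hmdef
  have hm0 : m ≠ 0 := by intro h; simp [h] at hm
  have hzm : 1 - (γ : ℂ) - γ * z * t = -z * m := by rw [hmdef]; field_simp; ring
  rw [hzm] at ht
  have hsum : (p : ℂ)⁻¹ * ∑ j, (lam j : ℂ) / (1 + lam j * m) * m = 1 + z * t := by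
    have hterm : ∀ j, (lam j : ℂ) / (1 + lam j * m) * m
        = 1 + z * (1 / ((lam j : ℂ) * (-z * m) - z)) := by
      intro j
      have h1 := one_add_real_mul_ne_zero hm (lam j)
      have h2 : (lam j : ℂ) * (-z * m) - z = -z * (1 + lam j * m) := by ring
      rw [h2]
      field_simp
      ring
    simp_rw [hterm]
    rw [Finset.sum_add_distrib, ← Finset.mul_sum, mul_add, mul_left_comm, ← ht]
    simp [hp0]
  -- Silverstein's form `-1/m = z - γ ∫ x / (1 + x m) dH(x)`; the integral has nonpositive imaginary
  -- part.
  have hinv : -1 / m = z + ((γ / p : ℝ) : ℂ) * ∑ j, -((lam j : ℂ) / (1 + lam j * m)) := by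
    rw [← Finset.sum_mul] at hsum
    rw [Finset.sum_neg_distrib, div_eq_iff hm0]
    push_cast
    have : (γ : ℂ) / p * (∑ j, (lam j : ℂ) / (1 + lam j * m)) * m = γ * (1 + z * t) := by
      rw [← hsum]; ring
    linear_combination this - hzm
  rw [hinv, Complex.add_im, Complex.im_ofReal_mul, Complex.im_sum]
  have : 0 ≤ γ / p * ∑ j, (-((lam j : ℂ) / (1 + lam j * m))).im := by
    refine mul_nonneg (by positivity) (Finset.sum_nonneg fun j _ => ?_)
    rw [Complex.neg_im]
    linarith [im_div_one_add_real_mul_nonpos hm (lam j)]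
  linarith

/-- The entries `-z + c lam j` of the diagonal middle factor stay away from zero, uniformly in the
dimension, in the aspect ratio and in the eigenvalues `lam j ∈ [0, C]`. The proof is the companion
estimate for the Marčenko–Pastur law; existence of the law is not needed, as the bound is immediate
for the zero measure. -/
theorem min_le_norm_middleFactor_entry_of_im_pos (n : ℕ) {p : ℕ} (lam : Fin p → ℝ) {C : ℝ}
    (hC : 0 < C) (h0 : ∀ j, 0 ≤ lam j) (hle : ∀ j, lam j ≤ C) {z : ℂ} (hz : 0 < z.im) (j : Fin p) :
    z.im * min (1 / 2) (z.im / (2 * C)) ≤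
      ‖-z + ((1 - (p : ℂ) / n) - z * ((p : ℂ) / n) * mpStieltjes n lam z) * lam j‖ := by
  have hzn : z.im ≤ ‖z‖ := (le_abs_self _).trans (Complex.abs_im_le_norm z)
  have hz0 : z ≠ 0 := by rintro rfl; simp at hz
  unfold mpStieltjes
  -- At `n = 0` this is `γ = 0`, which is harmless since only `0 ≤ γ` is needed.
  set γ : ℝ := (p : ℝ) / n with hγ
  have hγc : (p : ℂ) / n = (γ : ℂ) := by rw [hγ]; push_cast; rfl
  rw [hγc]
  rcases marchenkoPasturMap_isLaw_or_eq_zero (spectralDistribution lam) γ with h | h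
  · set t := stieltjes (marchenkoPasturMap (spectralDistribution lam) γ) z
    have hm := h.companion z hz
    have ht := h.equation z hz
    rw [integral_spectralDistribution lam
      (fun x => 1 / ((x : ℂ) * (1 - γ - γ * z * t) - z))] at ht
    have him := im_le_im_neg_inv_companion j.pos (by positivity) hz ht hm
    have hm0 : -(1 - (γ : ℂ)) / z + γ * t ≠ 0 := by
      intro h'
      rw [h'] at hm
      simp at hm
    have hb := min_le_norm_one_add_real_mul hm0 hz hC him (h0 j) (hle j)
    have he : -z + ((1 - (γ : ℂ)) - z * γ * t) * lam j
        = -z * (1 + lam j * (-(1 - (γ : ℂ)) / z + γ * t)) := by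
      field_simp
      ring
    rw [he, norm_mul, norm_neg]
    exact mul_le_mul hzn hb (by positivity) (norm_nonneg _)
  -- For the zero measure `t = 0`, so the coefficient of `lam j` is real.
  · have him : (-z + ((1 - (γ : ℂ)) - z * γ * stieltjes 0 z) * lam j).im = -z.im := by
      simp [stieltjes]
    rw [h]
    refine le_trans ?_ (Complex.abs_im_le_norm _)
    rw [him, abs_neg, abs_of_pos hz]
    have : min (1 / 2) (z.im / (2 * C)) ≤ 1 / 2 := min_le_left _ _
    nlinarith

theorem min_le_norm_middleFactor_entry (n : ℕ) {p : ℕ} (lam : Fin p → ℝ) {C : ℝ}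
    (hC : 0 < C) (h0 : ∀ j, 0 ≤ lam j) (hle : ∀ j, lam j ≤ C) {z : ℂ} (hz : z.im ≠ 0)
    (j : Fin p) :
    |z.im| * min (1 / 2) (|z.im| / (2 * C)) ≤
      ‖-z + ((1 - (p : ℂ) / n) - z * ((p : ℂ) / n) * mpStieltjes n lam z) * lam j‖ := by
  rcases hz.lt_or_gt with hneg | hpos
  · have hz' : 0 < ((starRingEnd ℂ) z).im := by simpa using hneg
    have h := min_le_norm_middleFactor_entry_of_im_pos n lam hC h0 hle hz' j
    have hconj : mpStieltjes n lam ((starRingEnd ℂ) z) = (starRingEnd ℂ) (mpStieltjes n lam z) :=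
      stieltjes_conj _ _
    rw [hconj, ← Complex.norm_conj] at h
    simpa [abs_of_neg hneg] using h
  · rw [abs_of_pos hpos]
    exact min_le_norm_middleFactor_entry_of_im_pos n lam hC h0 hle hpos j

end StieltjesBounds

/-! ### The matrices `Γ` as bounded functions of the eigenvalues. -/

section DiagonalForms

theorem middleFactor_eq_diagonal (n : ℕ) {p : ℕ} (lam : Fin p → ℝ) (z : ℂ) :
    middleFactor n lam z = Matrix.diagonal (fun j =>
      -z + ((1 - (p : ℂ) / n) - z * ((p : ℂ) / n) * mpStieltjes n lam z) * lam j) := by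
  unfold middleFactor
  rw [← Matrix.diagonal_one, ← Matrix.diagonal_smul, ← Matrix.diagonal_smul,
    Matrix.diagonal_add]
  congr 1
  ext j
  simp

theorem middleFactor_entry_ne_zero (n : ℕ) {p : ℕ} {lam : Fin p → ℝ} (h0 : ∀ j, 0 ≤ lam j)
    {z : ℂ} (hz : z.im ≠ 0) (j : Fin p) :
    -z + ((1 - (p : ℂ) / n) - z * ((p : ℂ) / n) * mpStieltjes n lam z) * lam j ≠ 0 := by
  -- Invertibility is needed for every `n`, but the common bound on eigenvalues holds only
  -- eventually; any positive bound depending on `n` suffices here.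
  have hS : 0 ≤ ∑ i, lam i := Finset.sum_nonneg fun i _ => h0 i
  have hC : 0 < 1 + ∑ i, lam i := by linarith
  have hle : ∀ i, lam i ≤ 1 + ∑ i, lam i := fun i => by
    linarith [Finset.single_le_sum (fun i _ => h0 i) (Finset.mem_univ i)]
  have hb := min_le_norm_middleFactor_entry n lam hC h0 hle hz j
  have hz' : 0 < |z.im| := abs_pos.mpr hz
  exact norm_pos_iff.mp (lt_of_lt_of_le (by positivity) hb)

theorem isUnit_middleFactor (n : ℕ) {p : ℕ} {lam : Fin p → ℝ} (h0 : ∀ j, 0 ≤ lam j)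
    {z : ℂ} (hz : z.im ≠ 0) : IsUnit (middleFactor n lam z) := by
  rw [middleFactor_eq_diagonal, Matrix.isUnit_diagonal, Pi.isUnit_iff]
  exact fun j => (middleFactor_entry_ne_zero n h0 hz j).isUnit

/-- The function `x ↦ x / (-z + c x) ^ l` of which `Γ_{n,l}(z)` is the diagonal matrix of values,
where `c = (1 - γ) - z γ t(z)`. -/
noncomputable def gammaFun (n : ℕ) {p : ℕ} (lam : Fin p → ℝ) (l : ℕ) (z : ℂ) (x : ℝ) : ℂ :=
  x / (-z + ((1 - (p : ℂ) / n) - z * ((p : ℂ) / n) * mpStieltjes n lam z) * x) ^ l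

theorem gammaMatrix_eq_diagonal (n : ℕ) {p : ℕ} {lam : Fin p → ℝ} (h0 : ∀ j, 0 ≤ lam j) (l : ℕ)
    {z : ℂ} (hz : z.im ≠ 0) :
    gammaMatrix n lam l z = Matrix.diagonal (fun j => gammaFun n lam l z (lam j)) := by
  have hinv : (middleFactor n lam z)⁻¹ = Matrix.diagonal (fun j =>
      (-z + ((1 - (p : ℂ) / n) - z * ((p : ℂ) / n) * mpStieltjes n lam z) * lam j)⁻¹) := by
    refine Matrix.inv_eq_left_inv ?_
    rw [middleFactor_eq_diagonal, Matrix.diagonal_mul_diagonal, ← Matrix.diagonal_one]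
    congr 1
    ext j
    exact inv_mul_cancel₀ (middleFactor_entry_ne_zero n h0 hz j)
  unfold gammaMatrix
  rw [hinv, Matrix.diagonal_pow, Matrix.diagonal_mul_diagonal, Matrix.diagonal_mul_diagonal]
  congr 1
  ext j
  have hs : ((√(lam j) : ℝ) : ℂ) * ((√(lam j) : ℝ) : ℂ) = lam j := by
    rw [← Complex.ofReal_mul, Real.mul_self_sqrt (h0 j)]
  simp only [gammaFun, Pi.pow_apply, div_eq_mul_inv, inv_pow]
  rw [mul_right_comm, hs]

theorem norm_gammaFun_le (n : ℕ) {p : ℕ} (lam : Fin p → ℝ) {C : ℝ} (hC : 0 < C)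
    (h0 : ∀ j, 0 ≤ lam j) (hle : ∀ j, lam j ≤ C) (l : ℕ) {z : ℂ} (hz : z.im ≠ 0) (j : Fin p) :
    ‖gammaFun n lam l z (lam j)‖ ≤ C / (|z.im| * min (1 / 2) (|z.im| / (2 * C))) ^ l := by
  have hz' : 0 < |z.im| := abs_pos.mpr hz
  have hb := min_le_norm_middleFactor_entry n lam hC h0 hle hz j
  unfold gammaFun
  rw [norm_div, norm_pow, Complex.norm_real, Real.norm_of_nonneg (h0 j)]
  gcongr
  exact hle j

end DiagonalForms

/-! ### Independence of the spectral decomposition. -/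

section SpectralDecompositions

variable {p : ℕ}

theorem conjBy_diagonal_apply_self (U : Matrix (Fin p) (Fin p) ℝ) (a : Fin p → ℂ) (j : Fin p) :
    conjBy U (Matrix.diagonal a) j j = ∑ k, ((U j k ^ 2 : ℝ) : ℂ) * a k := by
  unfold conjBy
  rw [Matrix.mul_apply]
  refine Finset.sum_congr rfl fun k _ => ?_
  rw [Matrix.mul_diagonal, Matrix.transpose_apply, Matrix.map_apply]
  push_cast
  ring

theorem trace_conjBy {U : Matrix (Fin p) (Fin p) ℝ} (hU : U ∈ Matrix.orthogonalGroup (Fin p) ℝ)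
    (A : Matrix (Fin p) (Fin p) ℂ) : (conjBy U A).trace = A.trace := by
  have h : (U.map (fun x : ℝ => (x : ℂ)))ᵀ * U.map (fun x : ℝ => (x : ℂ)) = 1 := by
    have h1 := congrArg Complex.ofRealHom.mapMatrix ((Matrix.mem_orthogonalGroup_iff' _ _).mp hU)
    rw [map_mul, map_one] at h1
    exact h1
  unfold conjBy
  rw [Matrix.trace_mul_comm, ← Matrix.mul_assoc, h, Matrix.one_mul]

section Comparison

variable {U V : Matrix (Fin p) (Fin p) ℝ} {lam mu : Fin p → ℝ}

/-- `UᵀV` intertwines the two diagonal matrices, so its nonzero entries occur only where the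
eigenvalues agree; it therefore intertwines every function of them. -/
theorem transpose_mul_apply_mul_eq_of_conj_eq (hU : U ∈ Matrix.orthogonalGroup (Fin p) ℝ)
    (hV : V ∈ Matrix.orthogonalGroup (Fin p) ℝ)
    (h : U * Matrix.diagonal lam * Uᵀ = V * Matrix.diagonal mu * Vᵀ) (i j : Fin p) :
    (Uᵀ * V) i j * mu j = lam i * (Uᵀ * V) i j := by
  have hU' : Uᵀ * U = 1 := (Matrix.mem_orthogonalGroup_iff' _ _).mp hU
  have hV' : Vᵀ * V = 1 := (Matrix.mem_orthogonalGroup_iff' _ _).mp hV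
  have hW : Uᵀ * V * Matrix.diagonal mu = Matrix.diagonal lam * (Uᵀ * V) := by
    calc Uᵀ * V * Matrix.diagonal mu = Uᵀ * (V * Matrix.diagonal mu * Vᵀ) * V := by
          simp only [Matrix.mul_assoc, hV', Matrix.mul_one]
      _ = Uᵀ * U * (Matrix.diagonal lam * (Uᵀ * V)) := by
          rw [← h]
          simp only [Matrix.mul_assoc]
      _ = _ := by rw [hU', Matrix.one_mul]
  have := congrFun (congrFun hW i) j
  rwa [Matrix.mul_diagonal, Matrix.diagonal_mul] at this

/-- The functional calculus of a symmetric matrix does not depend on the spectral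
decomposition. -/
theorem conjBy_diagonal_comp_eq_of_conj_eq (hU : U ∈ Matrix.orthogonalGroup (Fin p) ℝ)
    (hV : V ∈ Matrix.orthogonalGroup (Fin p) ℝ)
    (h : U * Matrix.diagonal lam * Uᵀ = V * Matrix.diagonal mu * Vᵀ) (f : ℝ → ℂ) :
    conjBy V (Matrix.diagonal (f ∘ mu)) = conjBy U (Matrix.diagonal (f ∘ lam)) := by
  have hU' := congrArg Complex.ofRealHom.mapMatrix ((Matrix.mem_orthogonalGroup_iff _ _).mp hU)
  have hV' := congrArg Complex.ofRealHom.mapMatrix ((Matrix.mem_orthogonalGroup_iff _ _).mp hV)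
  have hW : Complex.ofRealHom.mapMatrix (Uᵀ * V) * Matrix.diagonal (f ∘ mu) =
      Matrix.diagonal (f ∘ lam) * Complex.ofRealHom.mapMatrix (Uᵀ * V) := by
    ext i j
    rw [Matrix.mul_diagonal, Matrix.diagonal_mul]
    have hij := transpose_mul_apply_mul_eq_of_conj_eq hU hV h i j
    rw [RingHom.mapMatrix_apply, Matrix.map_apply]
    by_cases h0 : (Uᵀ * V) i j = 0
    · simp [h0]
    · have : mu j = lam i := by
        rw [mul_comm] at hij
        exact mul_right_cancel₀ h0 hij
      rw [Function.comp_apply, Function.comp_apply, this, mul_comm]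
  rw [map_mul] at hW hU' hV'
  rw [map_one] at hU' hV'
  change Complex.ofRealHom.mapMatrix V * _ * Complex.ofRealHom.mapMatrix Vᵀ =
    Complex.ofRealHom.mapMatrix U * _ * Complex.ofRealHom.mapMatrix Uᵀ
  change _ * Complex.ofRealHom.mapMatrix Uᵀ = _ at hU'
  change _ * Complex.ofRealHom.mapMatrix Vᵀ = _ at hV'
  generalize Complex.ofRealHom.mapMatrix U = u at *
  generalize Complex.ofRealHom.mapMatrix V = v at *
  generalize Complex.ofRealHom.mapMatrix Uᵀ = u' at *
  generalize Complex.ofRealHom.mapMatrix Vᵀ = v' at *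
  calc v * Matrix.diagonal (f ∘ mu) * v'
      = u * (u' * v * Matrix.diagonal (f ∘ mu)) * v' := by
        rw [← Matrix.mul_assoc, ← Matrix.mul_assoc, hU', Matrix.one_mul]
    _ = u * Matrix.diagonal (f ∘ lam) * u' * (v * v') := by
        rw [hW]
        simp only [Matrix.mul_assoc]
    _ = _ := by rw [hV', Matrix.mul_one]

theorem sum_comp_eq_of_conj_eq (hU : U ∈ Matrix.orthogonalGroup (Fin p) ℝ)
    (hV : V ∈ Matrix.orthogonalGroup (Fin p) ℝ)
    (h : U * Matrix.diagonal lam * Uᵀ = V * Matrix.diagonal mu * Vᵀ) (f : ℝ → ℂ) :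
    ∑ j, f (mu j) = ∑ j, f (lam j) := by
  have := congrArg Matrix.trace (conjBy_diagonal_comp_eq_of_conj_eq hU hV h f)
  simpa [trace_conjBy hU, trace_conjBy hV, Matrix.trace_diagonal] using this

theorem exists_eq_of_conj_eq (hU : U ∈ Matrix.orthogonalGroup (Fin p) ℝ)
    (hV : V ∈ Matrix.orthogonalGroup (Fin p) ℝ)
    (h : U * Matrix.diagonal lam * Uᵀ = V * Matrix.diagonal mu * Vᵀ) (j : Fin p) :
    ∃ i, mu j = lam i := by
  classical
  by_contra! hne
  -- Traces of an indicator function compare the multiplicities of the eigenvalue `mu j`.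
  have hsum := sum_comp_eq_of_conj_eq hU hV h (fun x => if x = mu j then 1 else 0)
  rw [Finset.sum_boole, Finset.sum_boole] at hsum
  have h1 : (Finset.univ.filter fun i => lam i = mu j) = ∅ :=
    Finset.filter_eq_empty_iff.mpr fun i _ => (hne i).symm
  rw [h1, Finset.card_empty] at hsum
  have h2 : (Finset.univ.filter fun i => mu i = mu j) = ∅ :=
    Finset.card_eq_zero.mp (by exact_mod_cast hsum)
  exact Finset.filter_eq_empty_iff.mp h2 (Finset.mem_univ j) rfl

end Comparison

end SpectralDecompositions

/-! ### Perturbation of diagonal entries by a reflection. -/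

section Reflections

variable {p : ℕ} {P : Matrix (Fin p) (Fin p) ℝ}

theorem reflection_mem_orthogonalGroup (hs : P.IsSymm) (hi : P * P = P) :
    1 - 2 • P ∈ Matrix.orthogonalGroup (Fin p) ℝ := by
  rw [Matrix.mem_orthogonalGroup_iff, Matrix.transpose_sub, Matrix.transpose_smul, hs.eq, Matrix.transpose_one, sub_mul, mul_sub,
    mul_sub, smul_mul_smul_comm, hi, one_mul, mul_one, one_mul]
  module

theorem sum_sq_row_orthogonal {U : Matrix (Fin p) (Fin p) ℝ}
    (hU : U ∈ Matrix.orthogonalGroup (Fin p) ℝ) (j : Fin p) : ∑ k, U j k ^ 2 = 1 := by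
  have h : (U * Uᵀ) j j = (1 : Matrix (Fin p) (Fin p) ℝ) j j :=
    congrFun (congrFun ((Matrix.mem_orthogonalGroup_iff _ _).mp hU) j) j
  rw [Matrix.mul_apply, Matrix.one_apply_eq] at h
  simpa [sq] using h

theorem sum_sq_row_projection (hs : P.IsSymm) (hi : P * P = P) (j : Fin p) :
    ∑ k, P j k ^ 2 = P j j := by
  have h := congrFun (congrFun hi j) j
  rw [Matrix.mul_apply] at h
  rw [← h]
  exact Finset.sum_congr rfl fun k _ => by rw [sq, hs.apply]

theorem trace_projection_eq_rank (hi : P * P = P) : P.trace = P.rank := by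
  have hidem : IsIdempotentElem (Matrix.toLin' P) := by
    change Matrix.toLin' P ∘ₗ Matrix.toLin' P = _
    rw [← Matrix.toLin'_mul, hi]
  rw [← Matrix.trace_toLin'_eq, (LinearMap.IsIdempotentElem.isProj_range _ hidem).trace]
  rfl

theorem norm_conjBy_diagonal_apply_self_le {U : Matrix (Fin p) (Fin p) ℝ}
    (hU : U ∈ Matrix.orthogonalGroup (Fin p) ℝ) {a : Fin p → ℂ} {K : ℝ} (ha : ∀ k, ‖a k‖ ≤ K)
    (j : Fin p) : ‖conjBy U (Matrix.diagonal a) j j‖ ≤ K := by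
  rw [conjBy_diagonal_apply_self]
  refine (norm_sum_le _ _).trans ?_
  calc ∑ k, ‖((U j k ^ 2 : ℝ) : ℂ) * a k‖ ≤ ∑ k, U j k ^ 2 * K := by
        refine Finset.sum_le_sum fun k _ => ?_
        rw [norm_mul, Complex.norm_real, Real.norm_of_nonneg (sq_nonneg _)]
        exact mul_le_mul_of_nonneg_left (ha k) (sq_nonneg _)
    _ = K := by rw [← Finset.sum_mul, sum_sq_row_orthogonal hU, one_mul]

/-- Rows of squares sum to 1, so the error is `∑ k, U j k ^ 2 * (a k - a j)`, whose term `k = j`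
vanishes. The constant 8 is `(-2)^2` times the bound `2K` on the difference. -/
theorem norm_conjBy_reflection_diagonal_sub_le (hs : P.IsSymm) (hi : P * P = P) {a : Fin p → ℂ}
    {K : ℝ} (ha : ∀ k, ‖a k‖ ≤ K) (j : Fin p) :
    ‖conjBy (1 - 2 • P) (Matrix.diagonal a) j j - a j‖ ≤ 8 * K * P j j := by
  have hU := reflection_mem_orthogonalGroup hs hi
  have he : ∀ k, j ≠ k → (1 - 2 • P : Matrix (Fin p) (Fin p) ℝ) j k = -2 * P j k :=
    fun k hjk => by
      rw [Matrix.sub_apply, Matrix.one_apply_ne hjk, Matrix.smul_apply, nsmul_eq_mul]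
      push_cast
      ring
  generalize (1 - 2 • P : Matrix (Fin p) (Fin p) ℝ) = U at hU he ⊢
  have hK : 0 ≤ K := (norm_nonneg _).trans (ha j)
  have hrow : ∑ k, ((U j k ^ 2 : ℝ) : ℂ) * a j = a j := by
    rw [← Finset.sum_mul, ← Complex.ofReal_sum, sum_sq_row_orthogonal hU, Complex.ofReal_one,
      one_mul]
  rw [conjBy_diagonal_apply_self]
  conv_lhs => arg 1; arg 2; rw [← hrow]
  rw [← Finset.sum_sub_distrib]
  refine (norm_sum_le _ _).trans ?_
  calc ∑ k, ‖((U j k ^ 2 : ℝ) : ℂ) * a k - ((U j k ^ 2 : ℝ) : ℂ) * a j‖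
      ≤ ∑ k, 8 * K * P j k ^ 2 := by
        refine Finset.sum_le_sum fun k _ => ?_
        rcases eq_or_ne j k with rfl | hjk
        · rw [sub_self, norm_zero]
          positivity
        · rw [he k hjk, ← mul_sub, norm_mul, Complex.norm_real, Real.norm_of_nonneg (sq_nonneg _)]
          have h2 : ‖a k - a j‖ ≤ 2 * K := by
            linarith [norm_sub_le (a k) (a j), ha k, ha j]
          calc (-2 * P j k) ^ 2 * ‖a k - a j‖ ≤ (-2 * P j k) ^ 2 * (2 * K) := by gcongr
            _ = 8 * K * P j k ^ 2 := by ring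
    _ = 8 * K * P j j := by rw [← Finset.mul_sum, sum_sq_row_projection hs hi]

/-- Changing one factor at a time costs `8 * K * L * P j j` twice, and `∑ j, P j j` is the rank. -/
theorem norm_diagAverage_reflection_sub_le (hs : P.IsSymm) (hi : P * P = P) {a b : Fin p → ℂ}
    {K L : ℝ} (ha : ∀ k, ‖a k‖ ≤ K) (hb : ∀ k, ‖b k‖ ≤ L) :
    ‖diagAverage (conjBy (1 - 2 • P) (Matrix.diagonal a)) (conjBy (1 - 2 • P) (Matrix.diagonal b)) -
      diagAverage (Matrix.diagonal a) (Matrix.diagonal b)‖ ≤ 16 * K * L * (P.rank / p) := by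
  have hU := reflection_mem_orthogonalGroup hs hi
  unfold diagAverage
  rw [← mul_sub, ← Finset.sum_sub_distrib, norm_mul, norm_inv, Complex.norm_natCast]
  have hsum : ‖∑ j, (conjBy (1 - 2 • P) (Matrix.diagonal a) j j *
      conjBy (1 - 2 • P) (Matrix.diagonal b) j j -
      Matrix.diagonal a j j * Matrix.diagonal b j j)‖ ≤ ∑ j, 16 * K * L * P j j := by
    refine (norm_sum_le _ _).trans (Finset.sum_le_sum fun j _ => ?_)
    have hK : 0 ≤ K := (norm_nonneg _).trans (ha j)
    rw [Matrix.diagonal_apply_eq, Matrix.diagonal_apply_eq]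
    have hsplit : conjBy (1 - 2 • P) (Matrix.diagonal a) j j *
        conjBy (1 - 2 • P) (Matrix.diagonal b) j j - a j * b j =
        (conjBy (1 - 2 • P) (Matrix.diagonal a) j j - a j) *
          conjBy (1 - 2 • P) (Matrix.diagonal b) j j +
        a j * (conjBy (1 - 2 • P) (Matrix.diagonal b) j j - b j) := by ring
    have h1 := norm_conjBy_reflection_diagonal_sub_le hs hi ha j
    have h2 := norm_conjBy_reflection_diagonal_sub_le hs hi hb j
    have h3 := norm_conjBy_diagonal_apply_self_le hU hb j
    rw [hsplit]
    refine (norm_add_le _ _).trans ?_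
    rw [norm_mul, norm_mul]
    calc _ ≤ 8 * K * P j j * L + K * (8 * L * P j j) :=
          add_le_add (mul_le_mul h1 h3 (norm_nonneg _) ((norm_nonneg _).trans h1))
            (mul_le_mul (ha j) h2 (norm_nonneg _) hK)
      _ = _ := by ring
  calc _ ≤ (p : ℝ)⁻¹ * ∑ j, 16 * K * L * P j j := by gcongr
    _ = 16 * K * L * (P.rank / p) := by
      rw [← Finset.mul_sum, ← trace_projection_eq_rank hi, Matrix.trace]
      simp only [Matrix.diag_apply]
      ring

end Reflections

theorem proposition4p2 (p : ℕ → ℕ)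
    (P : ∀ n, Matrix (Fin (p n)) (Fin (p n)) ℝ)
    (hsymm : ∀ n, (P n).IsSymm)
    (hidem : ∀ n, P n * P n = P n)
    (hrank : (fun n => ((P n).rank : ℝ)) =o[Filter.atTop] (fun n => (p n : ℝ)))
    (lam : ∀ n, Fin (p n) → ℝ)
    (hnonneg : ∀ n i, 0 ≤ lam n i)
    (hbdd : ∃ C : ℝ, ∀ᶠ n in Filter.atTop, ∀ i, lam n i ≤ C) :
    EigenvectorRegularity p
      (fun n => (1 - 2 • P n) * Matrix.diagonal (lam n) * (1 - 2 • P n)ᵀ) := by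
  obtain ⟨C₀, hC₀⟩ := hbdd
  intro V mu hdec
  have hU := fun n => reflection_mem_orthogonalGroup (hsymm n) (hidem n)
  have hmu : ∀ n j, ∃ i, mu n j = lam n i := fun n j =>
    exists_eq_of_conj_eq (hU n) (hdec n).1 (hdec n).2 j
  have hmu0 : ∀ n j, 0 ≤ mu n j := fun n j => by
    obtain ⟨i, hi⟩ := hmu n j
    exact hi ▸ hnonneg n i
  refine ⟨fun n z hz => isUnit_middleFactor n (hmu0 n) hz, fun z₁ z₂ hz₁ hz₂ l _ => ?_⟩
  -- `C₀` need not be positive.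
  set C := max C₀ 1
  have hC : 0 < C := lt_of_lt_of_le one_pos (le_max_right _ _)
  set K := C / (|z₁.im| * min (1 / 2) (|z₁.im| / (2 * C))) ^ l
  set L := C / (|z₂.im| * min (1 / 2) (|z₂.im| / (2 * C))) ^ 2
  have hlim : Filter.Tendsto (fun n => 16 * K * L * (((P n).rank : ℝ) / p n))
      Filter.atTop (nhds 0) := by
    simpa using hrank.tendsto_div_nhds_zero.const_mul (16 * K * L)
  refine squeeze_zero_norm' ?_ hlim
  filter_upwards [hC₀] with n hn
  have hmuC : ∀ j, mu n j ≤ C := fun j => by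
    obtain ⟨i, hi⟩ := hmu n j
    exact hi ▸ (hn i).trans (le_max_left _ _)
  -- Both functions use the transform built from `mu` and are evaluated at `lam` as well, so the
  -- transforms of the two eigenvalue lists need no comparison.
  set f := gammaFun n (mu n) l z₁
  set g := gammaFun n (mu n) 2 z₂
  have hlam : ∀ i, ∃ j, lam n i = mu n j := fun i =>
    exists_eq_of_conj_eq (hdec n).1 (hU n) (hdec n).2.symm i
  have hf : ∀ i, ‖(f ∘ lam n) i‖ ≤ K := fun i => by
    obtain ⟨j, hj⟩ := hlam i
    rw [Function.comp_apply, hj]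
    exact norm_gammaFun_le n (mu n) hC (hmu0 n) hmuC l hz₁ j
  have hg : ∀ i, ‖(g ∘ lam n) i‖ ≤ L := fun i => by
    obtain ⟨j, hj⟩ := hlam i
    rw [Function.comp_apply, hj]
    exact norm_gammaFun_le n (mu n) hC (hmu0 n) hmuC 2 hz₂ j
  have hdiag : diagAverage (Matrix.diagonal (f ∘ mu n)) (Matrix.diagonal (g ∘ mu n)) =
      diagAverage (Matrix.diagonal (f ∘ lam n)) (Matrix.diagonal (g ∘ lam n)) := by
    unfold diagAverage
    simp only [Matrix.diagonal_apply_eq, Function.comp_apply]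
    rw [sum_comp_eq_of_conj_eq (hU n) (hdec n).1 (hdec n).2 (fun x => f x * g x)]
  rw [gammaMatrix_eq_diagonal n (hmu0 n) l hz₁, gammaMatrix_eq_diagonal n (hmu0 n) 2 hz₂]
  change ‖diagAverage (conjBy (V n) (Matrix.diagonal (f ∘ mu n)))
      (conjBy (V n) (Matrix.diagonal (g ∘ mu n))) -
    diagAverage (Matrix.diagonal (f ∘ mu n)) (Matrix.diagonal (g ∘ mu n))‖ ≤ _
  rw [hdiag, conjBy_diagonal_comp_eq_of_conj_eq (hU n) (hdec n).1 (hdec n).2 f,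
    conjBy_diagonal_comp_eq_of_conj_eq (hU n) (hdec n).1 (hdec n).2 g]
  exact norm_diagAverage_reflection_sub_le (hsymm n) (hidem n) hf hg
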